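/- Let $K$ be a field. For integers $n>k\ge 1$ let ${\tt vdw}(n,k)$ be the simplicial complex on $\{1,\dots,n\}$ whose facets are the arithmetic progressions $\{i,i+d,\dots,i+kd\}\subseteq\{1,\dots,n\}$ with $d\ge 1$. Let $I_{{\tt vdw}(n,k)}\subseteq K[x_1,\dots,x_n]$ be its Stanley–Reisner ideal, generated by the monomials $\prod_{v\in F}x_v$ with $F\subseteq\{1,\dots,n\}$ not a face, and let $$A({\tt vdw}(n,k))=K[x_1,\dots,x_n]/\bigl(I_{{\tt vdw}(n,k)}+\langle x_1^2,\dots,x_n^2\rangle\bigr),$$ with its standard grading. A statement holds for a general linear form $\ell=a_1x_1+\cdots+a_nx_n$ if it holds for all coefficient vectors $(a_1,\dots,a_n)$ in some nonempty Zariski-open subset of $K^n$. A linear map has maximal rank if it is injective or surjective. A graded quotient $A=\bigoplus_i A_i$ of $K[x_1,\dots,x_n]$ has the WLP in degree $j$ if $\times\ell:A_j\to A_{j+1}$ has maximal rank for a general linear form $\ell$. It has the WLP if, for a general $\ell$, the maps $\times\ell:A_i\to A_{i+1}$ have maximal rank for all $i\ge 0$, and the SLP if, for a general $\ell$, the maps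 $\times\ell^d:A_i\to A_{i+d}$ have maximal rank for all $i,d\ge 0$. Then: 1. If $\operatorname{char}K\ne 2$, then $A({\tt vdw}(n,1))$ has the SLP for all $n\ge 2$. 2. If $\operatorname{char}K\ne 2$, then $A({\tt vdw}(n,2))$ has the WLP for all $n\ge 3$. 3. If $\operatorname{char}K=0$, then $A({\tt vdw}(n,n-1))$ has the SLP for all $n\ge 2$. 4. For all $n>k\ge 1$, $A({\tt vdw}(n,k))$ has the WLP in degree $0$, and, if $\operatorname{char}K\ne 2$, also in degree $1$. 5. For all $n>k\ge 1$ with $\frac n2\le k<n$, $A({\tt vdw}(n,k))$ has the WLP in degree $k$. -/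

import Mathlib

open MvPolynomial

/-- The arithmetic progression `{i, i + d, …, i + k d}` as a set of vertices, where the element
`v : Fin n` stands for the integer `v + 1` of `{1, …, n}`. -/
def apSet (n k i d : ℕ) : Finset (Fin n) :=
  Finset.univ.filter fun v => ∃ j ≤ k, (v : ℕ) + 1 = i + j * d

/-- The van der Waerden complex `vdw(n, k)` on the vertices `1, …, n`: the complex generated by the
arithmetic progressions `{i, i + d, …, i + k d} ⊆ {1, …, n}` with `d ≥ 1`. In Mathlib's convention
only the nonempty faces are listed. -/
def vdw (n k : ℕ) : PreAbstractSimplicialComplex (Fin n) where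
  faces := {F | F.Nonempty ∧
    ∃ i d : ℕ, 1 ≤ i ∧ 1 ≤ d ∧ i + k * d ≤ n ∧ F ⊆ apSet n k i d}
  isRelLowerSet_faces := by
    rintro F ⟨hF, i, d, hi, hd, hle, hsub⟩
    exact ⟨hF, fun G hGF hG => ⟨hG, i, d, hi, hd, hle, hGF.trans hsub⟩⟩

/-- For `k < n` every vertex is a face of `vdw(n, k)`. -/
theorem singleton_mem_vdw {n k : ℕ} (hkn : k < n) (v : Fin n) : {v} ∈ vdw n k := by
  refine ⟨Finset.singleton_nonempty v, min ((v : ℕ) + 1) (n - k), 1, by omega, le_rfl, by omega, ?_⟩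
  intro w hw
  obtain rfl := Finset.mem_singleton.mp hw
  have := w.isLt
  refine Finset.mem_filter.mpr ⟨Finset.mem_univ _, (w : ℕ) + 1 - min ((w : ℕ) + 1) (n - k), ?_, ?_⟩
  · omega
  · omega

section Lefschetz

variable (K : Type*) [Field K] {n : ℕ}

/-- The Stanley–Reisner ideal: generated by the squarefree monomials of the non-faces. The empty set
counts as a face. -/
noncomputable def stanleyReisnerIdeal (Δ : PreAbstractSimplicialComplex (Fin n)) :
    Ideal (MvPolynomial (Fin n) K) :=
  Ideal.span {m | ∃ F : Finset (Fin n), F.Nonempty ∧ F ∉ Δ ∧ m = ∏ v ∈ F, X v}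

/-- The ideal `I_Δ + ⟨x₁², …, xₙ²⟩`. -/
noncomputable def squareIdeal (Δ : PreAbstractSimplicialComplex (Fin n)) : Ideal (MvPolynomial (Fin n) K) :=
  stanleyReisnerIdeal K Δ ⊔ Ideal.span (Set.range fun v : Fin n => (X v : MvPolynomial (Fin n) K) ^ 2)

variable {K}

/-- The `i`-th graded piece of `A = K[x₁, …, xₙ] / I`: the classes of the homogeneous polynomials
of degree `i`. -/
noncomputable def gradedPiece (I : Ideal (MvPolynomial (Fin n) K)) (i : ℕ) :
    Submodule K (MvPolynomial (Fin n) K ⧸ I) :=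
  (homogeneousSubmodule (Fin n) K i).map (Ideal.Quotient.mkₐ K I).toLinearMap

/-- The linear form `a₁ x₁ + ⋯ + aₙ xₙ`. -/
noncomputable def linForm (a : Fin n → K) : MvPolynomial (Fin n) K :=
  ∑ v, C (a v) * X v

theorem linForm_isHomogeneous (a : Fin n → K) : (linForm a).IsHomogeneous 1 :=
  IsHomogeneous.sum _ _ _ fun v _ => by
    simpa using (isHomogeneous_C (Fin n) (a v)).mul (isHomogeneous_X K v)

/-- Multiplication by `ℓ ^ d` as a linear map `A_i → A_{i + d}`, for `ℓ = a₁ x₁ + ⋯ + aₙ xₙ`. -/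
noncomputable def mulPow (I : Ideal (MvPolynomial (Fin n) K)) (a : Fin n → K) (i d : ℕ) :
    gradedPiece I i →ₗ[K] gradedPiece I (i + d) :=
  (LinearMap.mulLeft K (Ideal.Quotient.mk I (linForm a) ^ d)).restrict <| by
    rintro _ ⟨p, hp, rfl⟩
    refine ⟨linForm a ^ d * p, ?_, by simp⟩
    have h := ((linForm_isHomogeneous a).pow d).mul hp
    rwa [one_mul, add_comm] at h

/-- The map `×ℓ ^ d : A_i → A_{i + d}` has maximal rank. -/
def HasMaxRank (I : Ideal (MvPolynomial (Fin n) K)) (a : Fin n → K) (i d : ℕ) : Prop :=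
  Function.Injective (mulPow I a i d) ∨ Function.Surjective (mulPow I a i d)

/-- `P` holds for a general linear form: for all coefficient vectors in some nonempty basic Zariski
open subset of `Kⁿ`. -/
def ForGeneralForm (P : (Fin n → K) → Prop) : Prop :=
  ∃ g : MvPolynomial (Fin n) K, (∃ a, eval a g ≠ 0) ∧ ∀ a, eval a g ≠ 0 → P a

/-- `K[x₁, …, xₙ] / I` has the weak Lefschetz property in degree `j`. -/
def HasWLPInDegree (I : Ideal (MvPolynomial (Fin n) K)) (j : ℕ) : Prop :=
  ForGeneralForm fun a => HasMaxRank I a j 1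

/-- `K[x₁, …, xₙ] / I` has the weak Lefschetz property. -/
def HasWLP (I : Ideal (MvPolynomial (Fin n) K)) : Prop :=
  ForGeneralForm fun a => ∀ i, HasMaxRank I a i 1

/-- `K[x₁, …, xₙ] / I` has the strong Lefschetz property. -/
def HasSLP (I : Ideal (MvPolynomial (Fin n) K)) : Prop :=
  ForGeneralForm fun a => ∀ i d, HasMaxRank I a i d

end Lefschetz

/-!
The ideal `squareIdeal K Δ` is spanned by monomials, and the monomials outside it are the squarefree
`x_G` with `G` a face (`mem_squareIdeal_iff`). So `A_i` has the faces of size `i` as a basis, and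
multiplication by `ℓ = ∑ a_v x_v` is a weighted incidence matrix between faces of sizes `i` and
`i + 1`, written here as an operator `up a` on functions on all subsets. When no `a_v` vanishes,
rescaling the variables turns `ℓ` into `∑ x_v`; hence the open set `∏ a_v ≠ 0` serves for every
degree at once and over every field, finite ones included (`forGeneralForm_of_ne_zero`). It remains
to see that the incidence matrices have full rank.

* Degree `0`: every vertex is a face, so the map is injective.
* Degree `1`: for `n ≥ 3` every vertex lies in a triangle of the `1`-skeleton, and the incidence
  matrix of an odd cycle is invertible away from characteristic `2`
  (`upInjective_one_one_of_close`).
* Top degree, for `k = 2` and for `n ≤ 2k`: each facet `F` has a codimension one face `F \ {r F}`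
  lying in no other facet, or, for `k = 2`, only in facets of larger common difference. The
  incidence matrix then contains a unitriangular block, so the map is surjective in every
  characteristic (`upSurjective_of_triangular`).
* `k = n - 1`: the complex is the full simplex, and `A` is the function space of the Boolean
  lattice. The raising operator `U` and its transpose `D` satisfy `D U - U D = n - 2 i` on
  `i`-sets, which in characteristic `0` makes `U ^ m` injective on `i`-sets when `m + 2 i ≤ n`
  (`IsSupportedOn.eq_zero_of_up_pow`). Comparing dimensions, `U ^ (n - 2 i)` is bijective onto
  `(n - i)`-sets, and the remaining surjectivities follow by factoring these bijections.
-/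

/-! ### Squarefree coefficients and the incidence operator -/

section FaceModel

variable {K : Type*} [Field K] {n : ℕ}

/-- The exponent vector of the squarefree monomial `x_G = ∏ v ∈ G, x_v`. -/
noncomputable def sqfreeExp (G : Finset (Fin n)) : Fin n →₀ ℕ := ∑ v ∈ G, Finsupp.single v 1

theorem sqfreeExp_apply (G : Finset (Fin n)) (v : Fin n) :
    sqfreeExp G v = if v ∈ G then 1 else 0 := by
  simp [sqfreeExp, Finsupp.finsetSum_apply, Finsupp.single_apply]

theorem sqfreeExp_injective : Function.Injective (sqfreeExp (n := n)) := by
  intro F G h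
  ext v
  have := DFunLike.congr_fun h v
  simp only [sqfreeExp_apply] at this
  by_cases hF : v ∈ F <;> by_cases hG : v ∈ G <;> simp_all

theorem sqfreeExp_le_iff {F G : Finset (Fin n)} : sqfreeExp F ≤ sqfreeExp G ↔ F ⊆ G := by
  constructor
  · intro h v hv
    have := h v
    simp only [sqfreeExp_apply, hv, if_true] at this
    by_contra hG
    simp [hG] at this
  · intro h v
    simp only [sqfreeExp_apply]
    by_cases hv : v ∈ F
    · simp [hv, h hv]
    · simp [hv]

theorem degree_sqfreeExp (G : Finset (Fin n)) : (sqfreeExp G).degree = G.card := by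
  simp [sqfreeExp, map_sum]

theorem sqfreeExp_erase (G : Finset (Fin n)) (v : Fin n) (hv : v ∈ G) :
    sqfreeExp G - Finsupp.single v 1 = sqfreeExp (G.erase v) := by
  ext w
  simp only [Finsupp.coe_tsub, Pi.sub_apply, sqfreeExp_apply, Finsupp.single_apply,
    Finset.mem_erase]
  by_cases h : v = w
  · subst h; simp [hv]
  · simp [h, Ne.symm h]

theorem monomial_sqfreeExp (F : Finset (Fin n)) :
    monomial (sqfreeExp F) (1 : K) = ∏ v ∈ F, X v := by
  simp [sqfreeExp, X, ← monomial_sum_one]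

/-- The faces of `Δ` together with the empty set, which `PreAbstractSimplicialComplex` leaves
out. -/
def IsFace (Δ : PreAbstractSimplicialComplex (Fin n)) (G : Finset (Fin n)) : Prop :=
  G.Nonempty → G ∈ Δ

theorem IsFace.mono {Δ : PreAbstractSimplicialComplex (Fin n)} {F G : Finset (Fin n)}
    (hG : IsFace Δ G) (h : F ⊆ G) : IsFace Δ F := fun hF =>
  ((Δ.isRelLowerSet_faces (hG (hF.mono h))).2 h hF)

theorem squareIdeal_eq_span_monomial (Δ : PreAbstractSimplicialComplex (Fin n)) :
    squareIdeal K Δ = Ideal.span ((fun s => monomial s (1 : K)) ''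
      ((sqfreeExp '' {F | ¬ IsFace Δ F}) ∪ Set.range fun v => Finsupp.single v 2)) := by
  rw [squareIdeal, stanleyReisnerIdeal, ← Ideal.span_union, Set.image_union, ← Set.range_comp,
    Set.image_image]
  congr 2
  · ext m
    simp only [Set.mem_ofPred_eq, Set.mem_image, IsFace, Classical.not_imp, monomial_sqfreeExp]
    constructor
    · rintro ⟨F, h1, h2, rfl⟩; exact ⟨F, ⟨h1, h2⟩, rfl⟩
    · rintro ⟨F, ⟨h1, h2⟩, rfl⟩; exact ⟨F, h1, h2, rfl⟩
  · ext v
    simp [X_pow_eq_monomial]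

/-- The ideal is spanned by monomials, and the monomials outside it are the `x_G` with `G` a
face. -/
theorem mem_squareIdeal_iff (Δ : PreAbstractSimplicialComplex (Fin n))
    (p : MvPolynomial (Fin n) K) :
    p ∈ squareIdeal K Δ ↔ ∀ G, IsFace Δ G → coeff (sqfreeExp G) p = 0 := by
  rw [squareIdeal_eq_span_monomial, mem_ideal_span_monomial_image]
  constructor
  · intro h G hG
    by_contra hne
    obtain ⟨s, hs | ⟨v, rfl⟩, hle⟩ := h _ (mem_support_iff.mpr hne)
    · obtain ⟨F, hF, rfl⟩ := hs
      exact hF (hG.mono (sqfreeExp_le_iff.mp hle))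
    · have := hle v
      simp only [Finsupp.single_eq_same, sqfreeExp_apply] at this
      split_ifs at this <;> omega
  · intro h m hm
    by_cases hsq : ∃ v, 2 ≤ m v
    · obtain ⟨v, hv⟩ := hsq
      exact ⟨_, Or.inr ⟨v, rfl⟩, by simpa using hv⟩
    · push Not at hsq
      have hmG : m = sqfreeExp m.support := by
        ext v
        rw [sqfreeExp_apply]
        have := hsq v
        simp only [Finsupp.mem_support_iff]
        split_ifs <;> omega
      refine ⟨m, Or.inl ⟨m.support, fun hF => ?_, hmG.symm⟩, le_rfl⟩
      have := h _ hF
      rw [← hmG] at this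
      exact (mem_support_iff.mp hm) this

/-- The function on subsets recording the coefficients of the squarefree monomials. -/
noncomputable def sqfreeCoeff : MvPolynomial (Fin n) K →ₗ[K] (Finset (Fin n) → K) :=
  LinearMap.pi fun G => lcoeff K (sqfreeExp G)

theorem sqfreeCoeff_apply (p : MvPolynomial (Fin n) K) (G : Finset (Fin n)) :
    sqfreeCoeff p G = coeff (sqfreeExp G) p := rfl

/-- Multiplication by `∑ a_v x_v` read on the coefficients of squarefree monomials. -/
def up (a : Fin n → K) : Module.End K (Finset (Fin n) → K) where
  toFun f G := ∑ v ∈ G, a v * f (G.erase v)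
  map_add' f g := by
    ext G
    simp [mul_add, Finset.sum_add_distrib]
  map_smul' c f := by
    ext G
    simp only [Pi.smul_apply, smul_eq_mul, RingHom.id_apply, Finset.mul_sum]
    exact Finset.sum_congr rfl fun v _ => by ring

theorem up_apply (a : Fin n → K) (f : Finset (Fin n) → K) (G : Finset (Fin n)) :
    up a f G = ∑ v ∈ G, a v * f (G.erase v) := rfl

theorem sqfreeCoeff_linForm_mul (a : Fin n → K) (p : MvPolynomial (Fin n) K) :
    sqfreeCoeff (linForm a * p) = up a (sqfreeCoeff p) := by
  ext G
  rw [sqfreeCoeff_apply, up_apply, linForm, Finset.sum_mul, coeff_sum,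
    ← Finset.sum_subset (Finset.subset_univ G)]
  · refine Finset.sum_congr rfl fun v hv => ?_
    rw [mul_assoc, coeff_C_mul, coeff_X_mul', sqfreeCoeff_apply, ← sqfreeExp_erase G v hv]
    simp [sqfreeExp_apply, hv]
  · intro v _ hv
    rw [mul_assoc, coeff_C_mul, coeff_X_mul']
    simp [sqfreeExp_apply, hv]

theorem sqfreeCoeff_linForm_pow_mul (a : Fin n → K) (d : ℕ) (p : MvPolynomial (Fin n) K) :
    sqfreeCoeff (linForm a ^ d * p) = (up a ^ d) (sqfreeCoeff p) := by
  induction d with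
  | zero => simp
  | succ d ih => rw [pow_succ', mul_assoc, sqfreeCoeff_linForm_mul, ih, pow_succ']; rfl

/-- The values of `ℓ ^ d · f` on `(i + d)`-sets depend only on the values of `f` on `i`-sets. -/
theorem up_pow_congr (a : Fin n → K) {f g : Finset (Fin n) → K} {i : ℕ}
    (h : ∀ G, G.card = i → f G = g G) (d : ℕ) :
    ∀ G, G.card = i + d → (up a ^ d) f G = (up a ^ d) g G := by
  induction d with
  | zero => simpa using h
  | succ d ih =>
    intro G hG
    rw [pow_succ', Module.End.mul_apply, Module.End.mul_apply, up_apply, up_apply]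
    refine Finset.sum_congr rfl fun v hv => ?_
    rw [ih _ (by rw [Finset.card_erase_of_mem hv]; omega)]

theorem up_pow_scale (a : Fin n → K) (ha : ∀ v, a v ≠ 0) (d : ℕ) (f : Finset (Fin n) → K)
    (G : Finset (Fin n)) :
    (up a ^ d) f G = (∏ v ∈ G, a v) * (up 1 ^ d) (fun F => (∏ v ∈ F, a v)⁻¹ * f F) G := by
  induction d generalizing G with
  | zero =>
    have : (∏ v ∈ G, a v) ≠ 0 := Finset.prod_ne_zero_iff.mpr fun v _ => ha v
    simp [this]
  | succ d ih =>
    rw [pow_succ', pow_succ', Module.End.mul_apply, Module.End.mul_apply, up_apply, up_apply,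
      Finset.mul_sum]
    refine Finset.sum_congr rfl fun v hv => ?_
    rw [ih, ← Finset.mul_prod_erase G a hv]
    simp [mul_assoc]

/-- Injectivity of `A_i → A_{i + d}` for the form `∑ x_v`, in terms of functions on subsets. -/
def UpInjective (K : Type*) [Field K] (Δ : PreAbstractSimplicialComplex (Fin n)) (i d : ℕ) :
    Prop :=
  ∀ f : Finset (Fin n) → K, (∀ G, IsFace Δ G → G.card = i + d → (up 1 ^ d) f G = 0) →
    ∀ G, IsFace Δ G → G.card = i → f G = 0

/-- Surjectivity of `A_i → A_{i + d}` for the form `∑ x_v`, in terms of functions on subsets. -/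
def UpSurjective (K : Type*) [Field K] (Δ : PreAbstractSimplicialComplex (Fin n)) (i d : ℕ) :
    Prop :=
  ∀ g : Finset (Fin n) → K, ∃ f : Finset (Fin n) → K,
    ∀ G, IsFace Δ G → G.card = i + d → (up 1 ^ d) f G = g G

variable {Δ : PreAbstractSimplicialComplex (Fin n)} {i d : ℕ} {a : Fin n → K}

theorem mulPow_injective (ha : ∀ v, a v ≠ 0) (h : UpInjective K Δ i d) :
    Function.Injective (mulPow (squareIdeal K Δ) a i d) := by
  rw [injective_iff_map_eq_zero]
  rintro ⟨_, p, hp, rfl⟩ hx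
  have hx : Ideal.Quotient.mk (squareIdeal K Δ) (linForm a ^ d * p) = 0 := by
    simpa [mulPow] using congrArg Subtype.val hx
  rw [Ideal.Quotient.eq_zero_iff_mem, mem_squareIdeal_iff] at hx
  have key : Ideal.Quotient.mk (squareIdeal K Δ) p = 0 := by
    rw [Ideal.Quotient.eq_zero_iff_mem, mem_squareIdeal_iff]
    intro G hG
    by_cases hc : G.card = i
    · have := h (fun F => (∏ v ∈ F, a v)⁻¹ * sqfreeCoeff p F) (fun F hF _ => ?_) G hG hc
      · exact (mul_eq_zero.mp this).resolve_left
          (inv_ne_zero (Finset.prod_ne_zero_iff.mpr fun v _ => ha v))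
      · have := hx F hF
        rw [← sqfreeCoeff_apply, sqfreeCoeff_linForm_pow_mul, up_pow_scale a ha] at this
        exact (mul_eq_zero.mp this).resolve_left (Finset.prod_ne_zero_iff.mpr fun v _ => ha v)
    · exact ((mem_homogeneousSubmodule i p).mp hp).coeff_eq_zero (by rwa [degree_sqfreeExp])
  exact Subtype.ext key

theorem mulPow_surjective (ha : ∀ v, a v ≠ 0) (h : UpSurjective K Δ i d) :
    Function.Surjective (mulPow (squareIdeal K Δ) a i d) := by
  rintro ⟨_, q, hq, rfl⟩
  obtain ⟨f, hf⟩ := h fun G => (∏ v ∈ G, a v)⁻¹ * sqfreeCoeff q G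
  let p : MvPolynomial (Fin n) K :=
    ∑ G ∈ Finset.univ.filter (fun G : Finset (Fin n) => G.card = i),
      monomial (sqfreeExp G) ((∏ v ∈ G, a v) * f G)
  have hp : p ∈ homogeneousSubmodule (Fin n) K i := by
    refine Submodule.sum_mem _ fun G hG => ?_
    exact isHomogeneous_monomial _ (by rw [degree_sqfreeExp]; exact (Finset.mem_filter.mp hG).2)
  have hpc : ∀ G : Finset (Fin n), G.card = i → sqfreeCoeff p G = (∏ v ∈ G, a v) * f G := by
    intro G hG
    simp only [p, sqfreeCoeff_apply, coeff_sum, coeff_monomial, sqfreeExp_injective.eq_iff]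
    simp [hG]
  refine ⟨⟨_, p, hp, rfl⟩, Subtype.ext ?_⟩
  have key : Ideal.Quotient.mk (squareIdeal K Δ) (linForm a ^ d * p) =
      Ideal.Quotient.mk (squareIdeal K Δ) q := by
    rw [Ideal.Quotient.eq, mem_squareIdeal_iff]
    intro G hG
    have hprod : (∏ v ∈ G, a v) ≠ 0 := Finset.prod_ne_zero_iff.mpr fun v _ => ha v
    rw [coeff_sub, sub_eq_zero]
    by_cases hc : G.card = i + d
    · rw [← sqfreeCoeff_apply, sqfreeCoeff_linForm_pow_mul,
        up_pow_congr a hpc d G hc, up_pow_scale a ha]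
      have hscale : (fun F : Finset (Fin n) => (∏ v ∈ F, a v)⁻¹ * ((∏ v ∈ F, a v) * f F)) = f := by
        ext F
        rw [inv_mul_cancel_left₀ (Finset.prod_ne_zero_iff.mpr fun v _ => ha v)]
      rw [hscale, hf G hG hc, mul_inv_cancel_left₀ hprod, sqfreeCoeff_apply]
    · have hhom := ((linForm_isHomogeneous a).pow d).mul ((mem_homogeneousSubmodule i p).mp hp)
      rw [((mem_homogeneousSubmodule _ q).mp hq).coeff_eq_zero (by rwa [degree_sqfreeExp]),
        hhom.coeff_eq_zero (by rw [degree_sqfreeExp]; omega)]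
  simpa [mulPow] using key

/-- Scaling the variables carries any form with nonzero coefficients to `∑ x_v`, so the general
form may be taken in the open set where no coefficient vanishes; this needs no assumption on the
size of `K`. -/
theorem forGeneralForm_of_ne_zero {P : (Fin n → K) → Prop} (h : ∀ a, (∀ v, a v ≠ 0) → P a) :
    ForGeneralForm P := by
  refine ⟨∏ v, X v, ⟨1, by simp⟩, fun a ha => h a fun v => ?_⟩
  rw [map_prod, Finset.prod_ne_zero_iff] at ha
  simpa using ha v (Finset.mem_univ v)

theorem hasMaxRank_of_up (ha : ∀ v, a v ≠ 0) (h : UpInjective K Δ i d ∨ UpSurjective K Δ i d) :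
    HasMaxRank (squareIdeal K Δ) a i d :=
  h.imp (mulPow_injective ha) (mulPow_surjective ha)

end FaceModel

/-! ### Rank criteria for a single step -/

section LowDegree

variable {K : Type*} [Field K] {n : ℕ} {Δ : PreAbstractSimplicialComplex (Fin n)} {i d : ℕ}

theorem upInjective_pow_zero (i : ℕ) : UpInjective K Δ i 0 := by
  intro f hf G hG hc
  simpa using hf G hG hc

theorem upSurjective_of_card_lt {m : ℕ} (hm : ∀ G, IsFace Δ G → G.card ≤ m) (h : m < i + d) :
    UpSurjective K Δ i d := fun _ => ⟨0, fun G hG hc => absurd (hm G hG) (by omega)⟩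

theorem upInjective_zero_one {v : Fin n} (hv : IsFace Δ {v}) : UpInjective K Δ 0 1 := by
  intro f hf G _ hc
  obtain rfl := Finset.card_eq_zero.mp hc
  simpa [up_apply] using hf {v} hv (by simp)

theorem up_one_pair (f : Finset (Fin n) → K) {u v : Fin n} (h : u ≠ v) :
    up 1 f {u, v} = f {v} + f {u} := by
  have h1 : ({u, v} : Finset (Fin n)).erase u = {v} := by
    ext w; simp only [Finset.mem_erase, Finset.mem_insert, Finset.mem_singleton]; grind
  have h2 : ({u, v} : Finset (Fin n)).erase v = {u} := by
    ext w; simp only [Finset.mem_erase, Finset.mem_insert, Finset.mem_singleton]; grind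
  rw [up_apply, Finset.sum_pair h, h1, h2]
  simp

theorem upInjective_zero_two (h2 : (2 : K) ≠ 0) {u v : Fin n} (huv : u ≠ v)
    (hf : IsFace Δ {u, v}) : UpInjective K Δ 0 2 := by
  intro f h G _ hc
  obtain rfl := Finset.card_eq_zero.mp hc
  have := h {u, v} hf (by rw [Finset.card_pair huv])
  rw [pow_two, Module.End.mul_apply, up_one_pair _ huv] at this
  simp only [up_apply, Finset.sum_singleton, Finset.erase_singleton, Pi.one_apply, one_mul,
    ← two_mul] at this
  exact (mul_eq_zero.mp this).resolve_left h2

/-- A linear form is injective in degree one if every vertex lies in a triangle of the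
`1`-skeleton: the triangle is an odd cycle, so its vertex-edge incidence matrix has determinant
`± 2`. -/
theorem upInjective_one_one (h2 : (2 : K) ≠ 0)
    (h : ∀ v : Fin n, ∃ u w, u ≠ v ∧ w ≠ v ∧ u ≠ w ∧
      IsFace Δ {u, v} ∧ IsFace Δ {v, w} ∧ IsFace Δ {u, w}) : UpInjective K Δ 1 1 := by
  intro f hf G _ hc
  obtain ⟨v, rfl⟩ := Finset.card_eq_one.mp hc
  obtain ⟨u, w, huv, hwv, huw, h1, h3, h4⟩ := h v
  have e1 := hf _ h1 (Finset.card_pair huv)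
  have e2 := hf _ h3 (Finset.card_pair hwv.symm)
  have e3 := hf _ h4 (Finset.card_pair huw)
  rw [pow_one, up_one_pair _ huv] at e1
  rw [pow_one, up_one_pair _ hwv.symm] at e2
  rw [pow_one, up_one_pair _ huw] at e3
  have : 2 * f {v} = 0 := by linear_combination e1 + e2 - e3
  exact (mul_eq_zero.mp this).resolve_left h2

theorem upInjective_one_one_of_close (h2 : (2 : K) ≠ 0) (hn : 3 ≤ n)
    (h : ∀ u v : Fin n, u < v → (v : ℕ) ≤ u + 2 → IsFace Δ {u, v}) : UpInjective K Δ 1 1 := by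
  have h' : ∀ u v : Fin n, u ≠ v → (v : ℕ) ≤ u + 2 → (u : ℕ) ≤ v + 2 → IsFace Δ {u, v} := by
    intro u v huv h1 h3
    rcases lt_or_gt_of_ne huv with h4 | h4
    · exact h u v h4 h1
    · rw [Finset.pair_comm]; exact h v u h4 h3
  refine upInjective_one_one h2 fun v => ?_
  have hv := v.isLt
  obtain ⟨u, w, huv, hwv, huw, h1⟩ : ∃ u w : Fin n, u ≠ v ∧ w ≠ v ∧ u ≠ w ∧
      ((v : ℕ) ≤ u + 2 ∧ (u : ℕ) ≤ v + 2 ∧ (v : ℕ) ≤ w + 2 ∧ (w : ℕ) ≤ v + 2 ∧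
        (w : ℕ) ≤ u + 2 ∧ (u : ℕ) ≤ w + 2) := by
    by_cases hv1 : (v : ℕ) + 2 < n
    · refine ⟨⟨v + 1, by omega⟩, ⟨v + 2, hv1⟩, ?_⟩
      simp only [ne_eq, Fin.ext_iff]; omega
    · by_cases hv2 : 2 ≤ (v : ℕ)
      · refine ⟨⟨v - 1, by omega⟩, ⟨v - 2, by omega⟩, ?_⟩
        simp only [ne_eq, Fin.ext_iff]; omega
      · refine ⟨⟨0, by omega⟩, ⟨2, by omega⟩, ?_⟩
        simp only [ne_eq, Fin.ext_iff]; omega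
  exact ⟨u, w, huv, hwv, huw, h' _ _ huv (by omega) (by omega), h' _ _ hwv.symm (by omega)
    (by omega), h' _ _ huw (by omega) (by omega)⟩

/-- A triangularity criterion. If the faces `F` of size `i + 1` have facets `F \ {r F}` such that
any other face of size `i + 1` through `F \ {r F}` has larger weight, then the incidence matrix
between faces of sizes `i` and `i + 1` contains a unitriangular block of full size. -/
theorem upSurjective_of_triangular (r : Finset (Fin n) → Fin n) (w : Finset (Fin n) → ℕ)
    (hr : ∀ F, IsFace Δ F → F.card = i + 1 → r F ∈ F)
    (hw : ∀ F F', IsFace Δ F → F.card = i + 1 → IsFace Δ F' → F'.card = i + 1 → F' ≠ F →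
      F.erase (r F) ⊆ F' → w F < w F') : UpSurjective K Δ i 1 := by
  classical
  let ι := {F : Finset (Fin n) // IsFace Δ F ∧ F.card = i + 1}
  let L : (Finset (Fin n) → K) →ₗ[K] (ι → K) :=
    (LinearMap.funLeft K K (Subtype.val : ι → Finset (Fin n))).comp (up 1)
  suffices hL : Function.Surjective L by
    intro g
    obtain ⟨f, hf⟩ := hL fun F => g F
    exact ⟨f, fun G hG hc => by simpa [L] using congrFun hf ⟨G, hG, hc⟩⟩
  rw [← LinearMap.range_eq_top]
  by_contra hne
  obtain ⟨φ, hφ, hle⟩ := Submodule.exists_le_ker_of_lt_top _ (lt_top_iff_ne_top.mpr hne)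
  apply hφ
  -- `φ` vanishes on the basis vector of every `F`, by downward induction on the weight
  have key : ∀ m (F : ι), (∀ F' : ι, w F' < w F + m) → φ (Pi.single F 1) = 0 := by
    intro m
    induction m with
    | zero => intro F hF; exact absurd (hF F) (by simp)
    | succ m ih =>
      intro F hF
      have h0 : φ (L (Pi.single (F.1.erase (r F)) 1)) = 0 := hle ⟨_, rfl⟩
      have hval : ∀ F' : ι, L (Pi.single (F.1.erase (r F)) 1) F' =
          if F.1.erase (r F) ⊆ F'.1 then 1 else 0 := by
        intro F'
        have hFc : (F.1.erase (r F)).card = i := by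
          rw [Finset.card_erase_of_mem (hr _ F.2.1 F.2.2), F.2.2]; rfl
        have : L (Pi.single (F.1.erase (r F)) 1) F' =
            ∑ v ∈ F'.1, if F'.1.erase v = F.1.erase (r F) then (1 : K) else 0 := by
          simp [L, LinearMap.funLeft_apply, up_apply, Pi.single_apply]
        rw [this]
        split_ifs with hsub
        · obtain ⟨v, hv⟩ : ∃ v, F'.1 \ F.1.erase (r F) = {v} := by
            rw [← Finset.card_eq_one, Finset.card_sdiff_of_subset hsub, hFc, F'.2.2]; omega
          have hvm : v ∈ F'.1 \ F.1.erase (r F) := by rw [hv]; simp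
          rw [Finset.mem_sdiff] at hvm
          rw [Finset.sum_eq_single v]
          · rw [if_pos]
            refine (Finset.eq_of_subset_of_card_le ?_ ?_).symm
            · intro x hx
              exact Finset.mem_erase.mpr ⟨fun h => hvm.2 (h ▸ hx), hsub hx⟩
            · rw [Finset.card_erase_of_mem hvm.1, hFc, F'.2.2]; rfl
          · intro u hu huv
            rw [if_neg]
            intro h
            have : v ∈ F'.1.erase u := Finset.mem_erase.mpr ⟨huv.symm, hvm.1⟩
            rw [h] at this
            exact hvm.2 this
          · intro h; exact absurd hvm.1 h
        · refine Finset.sum_eq_zero fun v _ => if_neg fun h => hsub ?_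
          rw [← h]; exact Finset.erase_subset _ _
      rw [LinearMap.pi_apply_eq_sum_univ φ (L _), Finset.sum_eq_single F] at h0
      · rw [hval, if_pos (Finset.erase_subset _ _), one_smul] at h0
        rw [← h0]
        congr 1
        ext F'
        simp [Pi.single_apply, eq_comm]
      · intro F' _ hF'
        rw [hval]
        split_ifs with hsub
        · have hlt := hw F F' F.2.1 F.2.2 F'.2.1 F'.2.2 (fun h => hF' (Subtype.ext h)) hsub
          have := ih F' fun F'' => by have := hF F''; omega
          rw [one_smul]
          refine Eq.trans (congrArg φ ?_) this
          ext F''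
          simp [Pi.single_apply, eq_comm]
        · simp
      · simp
  obtain ⟨m, hm⟩ : ∃ m, ∀ F' : ι, w F' < m := by
    refine ⟨∑ F : ι, w F + 1, fun F' => Nat.lt_succ_of_le ?_⟩
    exact Finset.single_le_sum (f := fun F : ι => w F) (fun _ _ => Nat.zero_le _)
      (Finset.mem_univ F')
  refine LinearMap.pi_ext' fun F => LinearMap.ext_ring ?_
  simpa using key m F fun F' => (hm F').trans_le (by omega)

end LowDegree

/-! ### The Boolean lattice -/

section Boolean

variable {K : Type*} [Field K] {n : ℕ}

/-- The lowering operator on functions on subsets, transpose to `up 1`. -/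
def down (K : Type*) [Field K] (n : ℕ) : Module.End K (Finset (Fin n) → K) where
  toFun f G := ∑ v ∈ Gᶜ, f (insert v G)
  map_add' f g := by
    ext G
    simp [Finset.sum_add_distrib]
  map_smul' c f := by
    ext G
    simp [Finset.mul_sum]

theorem down_apply (f : Finset (Fin n) → K) (G : Finset (Fin n)) :
    down K n f G = ∑ v ∈ Gᶜ, f (insert v G) := rfl

/-- The `sl₂` commutation relation on the Boolean lattice. -/
theorem down_up_apply (f : Finset (Fin n) → K) (G : Finset (Fin n)) :
    down K n (up 1 f) G = up 1 (down K n f) G + ((n : K) - 2 * G.card) * f G := by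
  have h1 : down K n (up 1 f) G =
      ∑ v ∈ Gᶜ, (f G + ∑ w ∈ G, f (insert v (G.erase w))) := by
    rw [down_apply]
    refine Finset.sum_congr rfl fun v hv => ?_
    have hv := Finset.mem_compl.mp hv
    rw [up_apply, Finset.sum_insert hv, Finset.erase_insert hv]
    simp only [Pi.one_apply, one_mul]
    congr 1
    refine Finset.sum_congr rfl fun w hw => ?_
    rw [Finset.erase_insert_of_ne (by rintro rfl; exact hv hw)]
  have h2 : up 1 (down K n f) G =
      ∑ w ∈ G, (f G + ∑ v ∈ Gᶜ, f (insert v (G.erase w))) := by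
    rw [up_apply]
    refine Finset.sum_congr rfl fun w hw => ?_
    rw [down_apply, Finset.compl_erase, Finset.sum_insert (by simpa using hw),
      Finset.insert_erase hw]
    simp
  have hc : (Gᶜ.card : K) = n - G.card := by
    rw [Finset.card_compl, Fintype.card_fin, Nat.cast_sub (by simpa using G.card_le_univ)]
  rw [h1, h2, Finset.sum_add_distrib, Finset.sum_add_distrib, Finset.sum_comm]
  simp only [Finset.sum_const, nsmul_eq_mul, hc]
  ring

theorem up_pow_succ_apply (m : ℕ) (f : Finset (Fin n) → K) :
    (up 1 ^ (m + 1)) f = up 1 ((up 1 ^ m) f) := by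
  rw [pow_succ', Module.End.mul_apply]

/-- `f` vanishes off the `i`-subsets. -/
def IsSupportedOn (f : Finset (Fin n) → K) (i : ℕ) : Prop := ∀ G, G.card ≠ i → f G = 0

theorem IsSupportedOn.up_pow {f : Finset (Fin n) → K} {i : ℕ} (hf : IsSupportedOn f i) (m : ℕ) :
    IsSupportedOn ((up 1 ^ m) f) (i + m) := by
  induction m with
  | zero => simpa using hf
  | succ m ih =>
    intro G hG
    rw [pow_succ', Module.End.mul_apply, up_apply]
    refine Finset.sum_eq_zero fun v hv => ?_
    have := Finset.card_erase_add_one hv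
    rw [ih _ (by omega), mul_zero]

theorem IsSupportedOn.lower {f : Finset (Fin n) → K} {i : ℕ} (hf : IsSupportedOn f (i + 1)) :
    IsSupportedOn (down K n f) i := by
  intro G hG
  rw [down_apply]
  refine Finset.sum_eq_zero fun v hv => hf _ ?_
  rw [Finset.card_insert_of_notMem (Finset.mem_compl.mp hv)]
  omega

theorem IsSupportedOn.down_up_pow {f : Finset (Fin n) → K} {i : ℕ} (hf : IsSupportedOn f i)
    (m : ℕ) : down K n ((up 1 ^ (m + 1)) f) = (up 1 ^ (m + 1)) (down K n f) +
      (((m : K) + 1) * ((n : K) - 2 * i - m)) • (up 1 ^ m) f := by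
  have step : ∀ m : ℕ, down K n ((up 1 ^ (m + 1)) f) =
      up 1 (down K n ((up 1 ^ m) f)) + ((n : K) - 2 * (i + m)) • (up 1 ^ m) f := by
    intro m
    ext G
    rw [pow_succ', Module.End.mul_apply, down_up_apply]
    simp only [Pi.add_apply, Pi.smul_apply, smul_eq_mul]
    by_cases hc : G.card = i + m
    · rw [hc]; push_cast; ring
    · rw [hf.up_pow m G hc]; simp
  induction m with
  | zero => rw [step]; simp
  | succ m ih =>
    rw [step, ih, map_add, map_smul, ← up_pow_succ_apply, ← up_pow_succ_apply, add_assoc,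
      ← add_smul]
    congr 2
    push_cast
    ring

/-- Lowering `U ^ m f = 0` gives `U ^ (m + 1) (D f) = 0`, so `D f = 0` by induction on the degree,
and then the commutation relation leaves a nonzero multiple of `U ^ (m - 1) f`. -/
theorem IsSupportedOn.eq_zero_of_up_pow [CharZero K] {i : ℕ} :
    ∀ {f : Finset (Fin n) → K}, IsSupportedOn f i → ∀ {m : ℕ}, m + 2 * i ≤ n →
      (up 1 ^ m) f = 0 → f = 0 := by
  induction i with
  | zero =>
    intro f hf m
    have hD : down K n f = 0 := by
      ext G
      rw [down_apply]
      refine Finset.sum_eq_zero fun v _ => hf _ ?_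
      exact (Finset.card_pos.mpr (Finset.insert_nonempty v G)).ne'
    induction m with
    | zero => intro _ h; simpa using h
    | succ m ih =>
      intro hm h
      refine ih (by omega) ?_
      have := hf.down_up_pow m
      rw [h, hD, map_zero, map_zero, zero_add, eq_comm, smul_eq_zero] at this
      refine this.resolve_left (mul_ne_zero (by exact_mod_cast m.succ_ne_zero) ?_)
      rw [sub_ne_zero]
      intro h'
      have : n = m := by exact_mod_cast (show (n : K) = m by simpa using h')
      omega
  | succ i ihi =>
    intro f hf m
    induction m with
    | zero => intro _ h; simpa using h
    | succ m ih =>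
      intro hm h
      refine ih (by omega) ?_
      have hrel := hf.down_up_pow m
      have hD : down K n f = 0 := by
        refine ihi hf.lower (m := m + 2) (by omega) ?_
        have := congrArg (up 1) hrel
        rw [h, map_zero, map_zero, map_add, map_smul, ← up_pow_succ_apply, ← up_pow_succ_apply, h,
          smul_zero, add_zero] at this
        exact this.symm
      rw [h, hD, map_zero, map_zero, zero_add, eq_comm, smul_eq_zero] at hrel
      refine hrel.resolve_left (mul_ne_zero (by exact_mod_cast m.succ_ne_zero) ?_)
      rw [sub_ne_zero]
      intro h'
      have : n = m + 2 * (i + 1) := by exact_mod_cast sub_eq_iff_eq_add.mp h'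
      omega

end Boolean

/-! ### Maximal rank on the full simplex -/

section FullSimplex

variable {K : Type*} [Field K] {n : ℕ} {Δ : PreAbstractSimplicialComplex (Fin n)} {i d : ℕ}

theorem eq_zero_of_up_pow_eq_zero [CharZero K] (h : 2 * i + d ≤ n) {f : Finset (Fin n) → K}
    (hf : ∀ G, G.card = i + d → (up 1 ^ d) f G = 0) : ∀ G, G.card = i → f G = 0 := by
  intro G hG
  let f' : Finset (Fin n) → K := fun F => if F.card = i then f F else 0
  have hs : IsSupportedOn f' i := fun F hF => if_neg hF
  have h0 : f' = 0 := by
    refine hs.eq_zero_of_up_pow (m := d) (by omega) ?_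
    ext F
    by_cases hc : F.card = i + d
    · rw [up_pow_congr 1 (g := f) (fun F hF => if_pos hF) d F hc, hf F hc]; rfl
    · exact hs.up_pow d F hc
  simpa [f', hG] using congrFun h0 G

theorem upInjective_of_full [CharZero K] (hΔ : ∀ G, IsFace Δ G) (h : 2 * i + d ≤ n) :
    UpInjective K Δ i d := fun _ hf G _ hG =>
  eq_zero_of_up_pow_eq_zero h (fun G hG => hf G (hΔ G) hG) G hG

/-- The middle maps `A_i → A_{n - i}` are injective between spaces of equal dimension. -/
theorem upSurjective_middle [CharZero K] (h : 2 * i + d = n) : UpSurjective K Δ i d := by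
  classical
  let S (j : ℕ) := {G : Finset (Fin n) // G.card = j}
  let ext0 : (S i → K) →ₗ[K] (Finset (Fin n) → K) :=
    Function.ExtendByZero.linearMap K (Subtype.val : S i → Finset (Fin n))
  have hext : ∀ f (G : S i), ext0 f G = f G := fun f G =>
    Subtype.val_injective.extend_apply _ _ _
  let L : (S i → K) →ₗ[K] (S (i + d) → K) :=
    (LinearMap.funLeft K K (Subtype.val : S (i + d) → Finset (Fin n))).comp
      ((up 1 ^ d : Module.End K (Finset (Fin n) → K)).comp ext0)
  have hL : Function.Injective L := by
    rw [injective_iff_map_eq_zero]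
    intro f hf
    ext G
    have := eq_zero_of_up_pow_eq_zero (f := ext0 f) h.le
      (fun F hF => congrFun hf ⟨F, hF⟩) G.1 G.2
    rwa [hext] at this
  have hdim : Module.finrank K (S i → K) = Module.finrank K (S (i + d) → K) := by
    rw [Module.finrank_fintype_fun_eq_card, Module.finrank_fintype_fun_eq_card,
      Fintype.card_finset_len, Fintype.card_finset_len, Fintype.card_fin]
    exact (Nat.choose_symm_of_eq_add (by omega))
  have hsurj := (LinearMap.injective_iff_surjective_of_finrank_eq_finrank hdim).mp hL
  intro g
  obtain ⟨f, hf⟩ := hsurj fun G => g G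
  exact ⟨ext0 f, fun G _ hG => congrFun hf ⟨G, hG⟩⟩

theorem UpSurjective.of_add {j e : ℕ} (h : UpSurjective K Δ j (e + d)) :
    UpSurjective K Δ (j + e) d := by
  intro g
  obtain ⟨f, hf⟩ := h g
  refine ⟨(up 1 ^ e) f, fun G hG hc => ?_⟩
  rw [← Module.End.mul_apply, ← pow_add, add_comm d e]
  exact hf G hG (by omega)

theorem up_maxRank_of_full [CharZero K] (hΔ : ∀ G, IsFace Δ G) (i d : ℕ) :
    UpInjective K Δ i d ∨ UpSurjective K Δ i d := by
  rcases le_or_gt (2 * i + d) n with h | h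
  · exact Or.inl (upInjective_of_full hΔ h)
  · right
    rcases le_or_gt (i + d) n with h' | h'
    · -- the map `A_j → A_{n - j}` with `n - j = i + d` factors through `A_i`
      obtain ⟨j, hj⟩ := Nat.exists_eq_add_of_le h'
      obtain ⟨e, rfl⟩ := Nat.exists_eq_add_of_le (show j ≤ i by omega)
      exact (upSurjective_middle (i := j) (d := e + d) (by omega)).of_add
    · exact upSurjective_of_card_lt (m := n) (fun G _ => by simpa using G.card_le_univ) h'

end FullSimplex

/-! ### Faces of the van der Waerden complex -/

section VanDerWaerden

variable {n k : ℕ}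

theorem isFace_vdw_of_subset {F : Finset (Fin n)} {i d : ℕ} (hi : 1 ≤ i) (hd : 1 ≤ d)
    (h : i + k * d ≤ n) (hF : F ⊆ apSet n k i d) : IsFace (vdw n k) F :=
  fun hne => ⟨hne, i, d, hi, hd, h, hF⟩

theorem card_apSet_le (i d : ℕ) : (apSet n k i d).card ≤ k + 1 := by
  have hsub : (apSet n k i d).image (fun v : Fin n => (v : ℕ) + 1) ⊆
      (Finset.range (k + 1)).image fun j => i + j * d := by
    intro x hx
    obtain ⟨v, hv, rfl⟩ := Finset.mem_image.mp hx
    obtain ⟨j, hj, h⟩ := (Finset.mem_filter.mp hv).2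
    exact Finset.mem_image.mpr ⟨j, by simpa using Nat.lt_succ_of_le hj, h.symm⟩
  rw [← Finset.card_image_of_injective (apSet n k i d)
    (f := fun v : Fin n => (v : ℕ) + 1) fun u v h => Fin.ext (by simpa using h)]
  exact (Finset.card_le_card hsub).trans (Finset.card_image_le.trans (by simp))

theorem card_le_of_isFace_vdw {F : Finset (Fin n)} (hF : IsFace (vdw n k) F) : F.card ≤ k + 1 := by
  rcases F.eq_empty_or_nonempty with rfl | hne
  · simp
  · obtain ⟨-, i, d, -, -, -, hsub⟩ := hF hne
    exact (Finset.card_le_card hsub).trans (card_apSet_le i d)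

/-- A facet of `vdw(n, k)` is the whole of a progression. -/
theorem exists_eq_apSet {F : Finset (Fin n)} (hF : IsFace (vdw n k) F) (hc : F.card = k + 1) :
    ∃ i d : ℕ, 1 ≤ i ∧ 1 ≤ d ∧ i + k * d ≤ n ∧ F = apSet n k i d := by
  obtain ⟨-, i, d, hi, hd, h, hsub⟩ := hF (Finset.card_pos.mp (by omega))
  exact ⟨i, d, hi, hd, h, Finset.eq_of_subset_of_card_le hsub (hc ▸ card_apSet_le i d)⟩

theorem mem_apSet {i d : ℕ} {v : Fin n} :
    v ∈ apSet n k i d ↔ ∃ j ≤ k, (v : ℕ) + 1 = i + j * d := by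
  simp [apSet]

theorem isFace_vdw_pair_of_le {u v : Fin n} (hkn : k < n) (huv : u < v) (h : (v : ℕ) ≤ u + k) :
    IsFace (vdw n k) {u, v} := by
  have := v.isLt
  have huv' : (u : ℕ) < v := huv
  refine isFace_vdw_of_subset (i := min ((u : ℕ) + 1) (n - k)) (d := 1) (by omega) le_rfl
    (by omega) fun w hw => mem_apSet.mpr ⟨(w : ℕ) + 1 - min ((u : ℕ) + 1) (n - k), ?_⟩
  have : w = u ∨ w = v := by simpa using hw
  rcases this with rfl | rfl <;> omega

theorem isFace_vdw_one_pair {u v : Fin n} (huv : u < v) : IsFace (vdw n 1) {u, v} := by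
  have := v.isLt
  have huv' : (u : ℕ) < v := huv
  refine isFace_vdw_of_subset (i := (u : ℕ) + 1) (d := (v : ℕ) - u) (by omega) (by omega)
    (by omega) fun w hw => mem_apSet.mpr ?_
  have : w = u ∨ w = v := by simpa using hw
  rcases this with rfl | rfl
  · exact ⟨0, by omega, by omega⟩
  · exact ⟨1, by omega, by omega⟩

theorem isFace_vdw_full (hn : 2 ≤ n) (F : Finset (Fin n)) : IsFace (vdw n (n - 1)) F :=
  isFace_vdw_of_subset (i := 1) (d := 1) le_rfl le_rfl (by omega) fun v _ =>
    mem_apSet.mpr ⟨v, by have := v.isLt; omega, by omega⟩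

variable {K : Type*} [Field K]

theorem upInjective_vdw_zero_one (hkn : k < n) : UpInjective K (vdw n k) 0 1 :=
  upInjective_zero_one (v := ⟨0, by omega⟩) fun _ => singleton_mem_vdw hkn _

/-- A three-term progression `{a, a + d, a + 2d}` loses its middle element. Any other three-term
progression through `a` and `a + 2d` has them as consecutive terms, so its common difference `2d`
is larger. -/
theorem upSurjective_vdw_two : UpSurjective K (vdw n 2) 2 1 := by
  rcases Nat.eq_zero_or_pos n with rfl | hn
  · exact upSurjective_of_card_lt (m := 0) (fun G _ => by simpa using G.card_le_univ) (by omega)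
  have hF : ∀ F : Finset (Fin n), ∃ (r : Fin n) (a d : ℕ), IsFace (vdw n 2) F → F.card = 2 + 1 →
      1 ≤ d ∧ a + 2 * d < n ∧ (r : ℕ) = a + d ∧
      ∀ v : Fin n, v ∈ F ↔ (v : ℕ) = a ∨ (v : ℕ) = a + d ∨ (v : ℕ) = a + 2 * d := by
    intro F
    by_cases hF : IsFace (vdw n 2) F ∧ F.card = 2 + 1
    · obtain ⟨i, d, hi, hd, h, rfl⟩ := exists_eq_apSet hF.1 hF.2
      refine ⟨⟨i - 1 + d, by omega⟩, i - 1, d, fun _ _ => ⟨hd, by omega, rfl, fun v => ?_⟩⟩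
      rw [mem_apSet]
      constructor
      · rintro ⟨j, hj, hv⟩
        interval_cases j <;> omega
      · rintro (hv | hv | hv)
        · exact ⟨0, by omega, by omega⟩
        · exact ⟨1, by omega, by omega⟩
        · exact ⟨2, by omega, by omega⟩
    · exact ⟨⟨0, hn⟩, 0, 0, fun h1 h2 => absurd ⟨h1, h2⟩ hF⟩
  choose r a d h using hF
  refine upSurjective_of_triangular r d (fun F hF hc => ?_) fun F F' hF hc hF' hc' hne hsub => ?_
  · obtain ⟨-, -, hr, hm⟩ := h F hF hc
    exact (hm _).mpr (by omega)
  · obtain ⟨hd, hlt, hr, hm⟩ := h F hF hc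
    obtain ⟨hd', hlt', hr', hm'⟩ := h F' hF' hc'
    have h1 := (hm' _).mp (hsub (Finset.mem_erase.mpr
      ⟨(by rw [ne_eq, Fin.ext_iff]; simp only; omega), (hm ⟨a F, by omega⟩).mpr (Or.inl rfl)⟩))
    have h2 := (hm' _).mp (hsub (Finset.mem_erase.mpr
      ⟨(by rw [ne_eq, Fin.ext_iff]; simp only; omega),
        (hm ⟨a F + 2 * d F, hlt⟩).mpr (Or.inr (Or.inr rfl))⟩))
    simp only at h1 h2
    by_contra hle
    have h3 : a F' = a F ∧ d F' = d F := by omega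
    exact hne (Finset.ext fun v => by rw [hm, hm', h3.1, h3.2])

/-- For `n ≤ 2k` the facets are intervals of length `k + 1`. Each is determined by its endpoints,
hence by what is left after removing its second element; for `k = 1` there is only one facet. -/
theorem upSurjective_vdw_of_half_le (hk : 1 ≤ k) (hnk : n ≤ 2 * k) (hkn : k < n) :
    UpSurjective K (vdw n k) k 1 := by
  have hF : ∀ F : Finset (Fin n), ∃ (r : Fin n) (a : ℕ), IsFace (vdw n k) F → F.card = k + 1 →
      a + k < n ∧ (r : ℕ) = a + 1 ∧ ∀ v : Fin n, v ∈ F ↔ a ≤ v ∧ (v : ℕ) ≤ a + k := by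
    intro F
    by_cases hF : IsFace (vdw n k) F ∧ F.card = k + 1
    · obtain ⟨i, d, hi, hd, h, rfl⟩ := exists_eq_apSet hF.1 hF.2
      obtain rfl : d = 1 := by
        by_contra hd1
        have : k * 2 ≤ k * d := Nat.mul_le_mul_left k (by omega)
        omega
      refine ⟨⟨i - 1 + 1, by omega⟩, i - 1, fun _ _ => ⟨by omega, rfl, fun v => ?_⟩⟩
      rw [mem_apSet]
      constructor
      · rintro ⟨j, hj, hv⟩
        omega
      · rintro ⟨h1, h2⟩
        exact ⟨(v : ℕ) + 1 - i, by omega, by omega⟩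
    · exact ⟨⟨0, by omega⟩, 0, fun h1 h2 => absurd ⟨h1, h2⟩ hF⟩
  choose r a h using hF
  refine upSurjective_of_triangular r (fun _ => 0) (fun F hF hc => ?_)
    fun F F' hF hc hF' hc' hne hsub => ?_
  · obtain ⟨-, hr, hm⟩ := h F hF hc
    exact (hm _).mpr (by omega)
  · obtain ⟨hlt, hr, hm⟩ := h F hF hc
    obtain ⟨hlt', hr', hm'⟩ := h F' hF' hc'
    have key : ∀ v : Fin n, a F ≤ v → (v : ℕ) ≤ a F + k → (v : ℕ) ≠ a F + 1 →
        a F' ≤ v ∧ (v : ℕ) ≤ a F' + k := fun v h1 h2 h3 =>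
      (hm' v).mp (hsub (Finset.mem_erase.mpr
        ⟨by rw [ne_eq, Fin.ext_iff]; omega, (hm v).mpr ⟨h1, h2⟩⟩))
    have h1 := key ⟨a F, by omega⟩ (by simp) (by simp) (by simp)
    have h3 : a F' = a F := by
      rcases hk.eq_or_lt with rfl | hk
      · omega
      · have h2 := key ⟨a F + k, by omega⟩ (by simp) (by simp) (by simp only; omega)
        simp only at h1 h2
        omega
    exact absurd (Finset.ext fun v => by rw [hm, hm', h3]) hne

end VanDerWaerden

theorem theorem1p1 (K : Type*) [Field K] :
    ((2 : K) ≠ 0 → ∀ n : ℕ, 2 ≤ n → HasSLP (squareIdeal K (vdw n 1))) ∧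
    ((2 : K) ≠ 0 → ∀ n : ℕ, 3 ≤ n → HasWLP (squareIdeal K (vdw n 2))) ∧
    (CharZero K → ∀ n : ℕ, 2 ≤ n → HasSLP (squareIdeal K (vdw n (n - 1)))) ∧
    (∀ n k : ℕ, 1 ≤ k → k < n →
      HasWLPInDegree (squareIdeal K (vdw n k)) 0 ∧
      ((2 : K) ≠ 0 → HasWLPInDegree (squareIdeal K (vdw n k)) 1)) ∧
    (∀ n k : ℕ, 1 ≤ k → (n : ℚ) / 2 ≤ k → k < n →
      HasWLPInDegree (squareIdeal K (vdw n k)) k) := by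
  have deg1 : (2 : K) ≠ 0 → ∀ n k : ℕ, 1 ≤ k → k < n →
      UpInjective K (vdw n k) 1 1 ∨ UpSurjective K (vdw n k) 1 1 := by
    intro h2 n k hk hkn
    rcases Nat.lt_or_ge n 3 with hn | hn
    · obtain rfl : n = 2 := by omega
      obtain rfl : k = 1 := by omega
      exact Or.inr (upSurjective_vdw_of_half_le le_rfl le_rfl (by omega))
    · refine Or.inl (upInjective_one_one_of_close h2 hn fun u v huv h => ?_)
      rcases hk.eq_or_lt with rfl | hk
      · exact isFace_vdw_one_pair huv
      · exact isFace_vdw_pair_of_le hkn huv (by omega)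
  refine ⟨fun h2 n hn => ?_, fun h2 n hn => ?_, fun _ n hn => ?_,
    fun n k hk hkn => ⟨?_, fun h2 => ?_⟩, fun n k hk hnk hkn => ?_⟩
  · refine forGeneralForm_of_ne_zero fun a ha i d => hasMaxRank_of_up ha ?_
    have hlarge : 2 < i + d → UpInjective K (vdw n 1) i d ∨ UpSurjective K (vdw n 1) i d :=
      fun h => Or.inr (upSurjective_of_card_lt (fun _ => card_le_of_isFace_vdw) h)
    match i, d with
    | i, 0 => exact Or.inl (upInjective_pow_zero i)
    | 0, 1 => exact Or.inl (upInjective_vdw_zero_one (by omega))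
    | 0, 2 =>
      exact Or.inl (upInjective_zero_two h2 (u := ⟨0, by omega⟩) (v := ⟨1, by omega⟩)
        (by simp) (isFace_vdw_one_pair (by simp)))
    | 1, 1 => exact deg1 h2 n 1 le_rfl (by omega)
    | 0, d + 3 => exact hlarge (by omega)
    | 1, d + 2 => exact hlarge (by omega)
    | i + 2, d + 1 => exact hlarge (by omega)
  · refine forGeneralForm_of_ne_zero fun a ha i => hasMaxRank_of_up ha ?_
    match i with
    | 0 => exact Or.inl (upInjective_vdw_zero_one (by omega))
    | 1 => exact deg1 h2 n 2 (by omega) (by omega)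
    | 2 => exact Or.inr upSurjective_vdw_two
    | i + 3 =>
      exact Or.inr (upSurjective_of_card_lt (m := 3) (fun _ => card_le_of_isFace_vdw) (by omega))
  · exact forGeneralForm_of_ne_zero fun a ha i d =>
      hasMaxRank_of_up ha (up_maxRank_of_full (isFace_vdw_full hn) i d)
  · exact forGeneralForm_of_ne_zero fun a ha =>
      hasMaxRank_of_up ha (Or.inl (upInjective_vdw_zero_one hkn))
  · exact forGeneralForm_of_ne_zero fun a ha => hasMaxRank_of_up ha (deg1 h2 n k hk hkn)
  · have hnk' : n ≤ 2 * k := by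
      have : (n : ℚ) ≤ 2 * k := by linarith
      exact_mod_cast this
    exact forGeneralForm_of_ne_zero fun a ha =>
      hasMaxRank_of_up ha (Or.inr (upSurjective_vdw_of_half_le hk hnk' hkn))
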